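/- Let $\mathcal C\subseteq\mathbb F_2^N$ be a binary linear code of length $N$. A codeword $X$ is chosen uniformly at random from $\mathcal C$ and sent over the binary erasure channel BEC$(\epsilon)$, which independently erases each bit with probability $\epsilon$ and otherwise delivers it unchanged; let $Y\in\{0,1,?\}^N$ be the received word and $p(y\mid x)$ the transition probability. Let $P_{\rm MAP}(\epsilon)$ be the block-MAP error probability, where a tie counts as an error: it is the probability that $X$ is not the unique maximizer of $x\mapsto p(Y\mid x)$ over $x\in\mathcal C$ (for $0<\epsilon<1$: the probability that the set of erased positions contains the support of some non-zero codeword). Let $A(w)$ be the number of codewords of Hamming weight $w$, and let $A(W,z)=\sum_{w=1}^{W}A(w)z^w$. Let $\Phi(x)=\int_{-\infty}^x\frac1{\sqrt{2\pi}}e^{-u^2/2}\,du$. Suppose that $0<\epsilon^*<1$ and $P_{\rm MAP}(\epsilon^*)=\frac12$. Then for every integer $1\le W\le N$ the following hold. For every $0<\epsilon<\epsilon^*$, $$P_{\rm MAP}(\epsilon)\le \Phi\!\left(\sqrt W\left(\sqrt{-\ln \epsilon^*}-\sqrt{-\ln\epsilon}\right)\right)+2\sqrt{-\ln\epsilon}\,\sqrt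 W\,A(W,\epsilon^*).$$ For every $\epsilon^*<\epsilon<1$, $$P_{\rm MAP}(\epsilon)\ge \Phi\!\left(\sqrt W\left(\sqrt{-\ln \epsilon^*}-\sqrt{-\ln\epsilon}\right)\right)-2\sqrt{-\ln\epsilon^*}\,\sqrt W\,A(W,\epsilon).$$ -/

import Mathlib

/-- Transition probability of one use of the binary erasure channel with erasure probability `ε`:
the output `none` is the erasure symbol, and `some c` is the received bit `c`. -/
noncomputable def becLetter (ε : ℝ) (a : ZMod 2) : Option (ZMod 2) → ℝ
  | none => ε
  | some c => if c = a then 1 - ε else 0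

/-- Transition probability `p(y | x)` of `N` independent uses of the binary erasure channel. -/
noncomputable def becProb {N : ℕ} (ε : ℝ) (x : Fin N → ZMod 2) (y : Fin N → Option (ZMod 2)) : ℝ :=
  ∏ i, becLetter ε (x i) (y i)

/-- A block-MAP error occurs when `x` is sent and `y` is received: some other codeword is at least
as likely as `x`, that is, `x` is not the unique maximizer of `p(y | ·)` over the code. -/
def IsBlockMAPError {N : ℕ} (C : Submodule (ZMod 2) (Fin N → ZMod 2)) (ε : ℝ)
    (x : Fin N → ZMod 2) (y : Fin N → Option (ZMod 2)) : Prop :=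
  ∃ x' ∈ C, x' ≠ x ∧ becProb ε x y ≤ becProb ε x' y

open Classical in
/-- The block-MAP error probability: the codeword is uniform on `C`, and it is sent over the binary
erasure channel with erasure probability `ε`. -/
noncomputable def blockMAPErrorProb {N : ℕ} (C : Submodule (ZMod 2) (Fin N → ZMod 2))
    (ε : ℝ) : ℝ :=
  ∑ x : C, (1 / (Fintype.card C : ℝ)) *
    ∑ y : Fin N → Option (ZMod 2),
      if IsBlockMAPError C ε (x : Fin N → ZMod 2) y then becProb ε (x : Fin N → ZMod 2) y else 0

/-- The weight distribution `A(w)`: the number of codewords of Hamming weight `w`. -/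
noncomputable def weightDistribution {N : ℕ} (C : Submodule (ZMod 2) (Fin N → ZMod 2))
    (w : ℕ) : ℕ :=
  Set.ncard {x : Fin N → ZMod 2 | x ∈ C ∧ hammingNorm x = w}

/-- The truncated weight enumerator `A(W, z) = ∑_{w=1}^W A(w) z^w`. -/
noncomputable def truncWeightEnumerator {N : ℕ} (C : Submodule (ZMod 2) (Fin N → ZMod 2))
    (W : ℕ) (z : ℝ) : ℝ :=
  ∑ w ∈ Finset.Icc 1 W, (weightDistribution C w : ℝ) * z ^ w

/-- The cumulative distribution function of the standard normal distribution. -/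
noncomputable def stdNormalCDF (x : ℝ) : ℝ :=
  ∫ u in Set.Iic x, 1 / Real.sqrt (2 * Real.pi) * Real.exp (-u ^ 2 / 2)

/-! A MAP error occurs exactly when the erased set contains the support of a nonzero codeword. This
is an increasing event; let f(p) be its probability under Bernoulli(p) erasures, and h the number of
its pivotal coordinates. Margulis–Russo gives p f' = E[h] (`hasDerivAt_bernoulliProb`). With I =
φ∘Φ⁻¹, an isoperimetric inequality on the cube gives I(f) ≤ 2√(-ln p) E[√h]
(`gaussianProfile_bernoulliProb_le`).

Were h always 0 or larger than W, then √W √h ≤ h would yield p f' ≥ √W I(f) / (2√(-ln p)). The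
Gaussian curve G of the theorem solves this relation with equality, and G = f = 1/2 at ε*, so f
would have a threshold at least as sharp as that of G.

Linearity controls the remaining patterns: if a pivotal coordinate exists, the erased set contains
the support of a single nonzero codeword, and h is its weight
(`exists_hammingNorm_eq_ncard_pivotal`). Patterns with 0 < h ≤ W therefore cost at most a sum over
codewords of weight at most W. Let S be an antiderivative of that cost. Then f - G + S is
nondecreasing wherever I(G) ≤ I(f), and a comparison argument on each side of ε* bounds the error by
an increment of S, which `smallWeightPotential_sub_le` estimates. -/

open Filter Topology

/-! ### Standard normal density and distribution function. -/

/-- The density of the standard normal distribution. -/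
noncomputable def stdNormalPDF (u : ℝ) : ℝ :=
  1 / Real.sqrt (2 * Real.pi) * Real.exp (-u ^ 2 / 2)

lemma stdNormalPDF_pos (u : ℝ) : 0 < stdNormalPDF u := by
  unfold stdNormalPDF; positivity

lemma stdNormalPDF_neg (u : ℝ) : stdNormalPDF (-u) = stdNormalPDF u := by
  simp [stdNormalPDF]

lemma continuous_stdNormalPDF : Continuous stdNormalPDF := by
  unfold stdNormalPDF; fun_prop

lemma hasDerivAt_stdNormalPDF (u : ℝ) :
    HasDerivAt stdNormalPDF (-u * stdNormalPDF u) u := by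
  have h : HasDerivAt (fun u : ℝ => -u ^ 2 / 2) (-u) u := by
    have := ((hasDerivAt_pow 2 u).neg).div_const 2
    refine HasDerivAt.congr_deriv this ?_
    norm_num
    ring
  have := (h.exp).const_mul (1 / Real.sqrt (2 * Real.pi))
  refine HasDerivAt.congr_deriv this ?_
  unfold stdNormalPDF; ring

lemma stdNormalPDF_eq_gaussianPDFReal : 
    stdNormalPDF = ProbabilityTheory.gaussianPDFReal 0 1 := by
  ext u
  simp [stdNormalPDF, ProbabilityTheory.gaussianPDFReal]

lemma integrable_stdNormalPDF : MeasureTheory.Integrable stdNormalPDF := by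
  rw [stdNormalPDF_eq_gaussianPDFReal]
  exact ProbabilityTheory.integrable_gaussianPDFReal 0 1

lemma integral_stdNormalPDF : ∫ u, stdNormalPDF u = 1 := by
  rw [stdNormalPDF_eq_gaussianPDFReal]
  exact ProbabilityTheory.integral_gaussianPDFReal_eq_one 0 one_ne_zero

lemma stdNormalCDF_eq (x : ℝ) : stdNormalCDF x = ∫ u in Set.Iic x, stdNormalPDF u := rfl

lemma hasDerivAt_stdNormalCDF (x : ℝ) : HasDerivAt stdNormalCDF (stdNormalPDF x) x := by
  have h : ∀ y, stdNormalCDF y = stdNormalCDF 0 + ∫ u in (0 : ℝ)..y, stdNormalPDF u := fun y => by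
    rw [stdNormalCDF_eq, stdNormalCDF_eq, ← intervalIntegral.integral_Iic_sub_Iic
      integrable_stdNormalPDF.integrableOn integrable_stdNormalPDF.integrableOn]
    ring
  have := (continuous_stdNormalPDF.integral_hasStrictDerivAt 0 x).hasDerivAt.const_add
    (stdNormalCDF 0)
  exact this.congr_of_eventuallyEq (Eventually.of_forall h)

lemma continuous_stdNormalCDF : Continuous stdNormalCDF :=
  continuous_iff_continuousAt.2 fun x => (hasDerivAt_stdNormalCDF x).continuousAt

lemma strictMono_stdNormalCDF : StrictMono stdNormalCDF :=
  strictMono_of_deriv_pos fun x => by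
    rw [(hasDerivAt_stdNormalCDF x).deriv]; exact stdNormalPDF_pos x

lemma stdNormalCDF_neg (x : ℝ) : stdNormalCDF (-x) = 1 - stdNormalCDF x := by
  have h1 : stdNormalCDF (-x) = ∫ u in Set.Ioi x, stdNormalPDF u := by
    rw [stdNormalCDF_eq, ← integral_comp_neg_Ioi]
    simp [stdNormalPDF_neg]
  have h2 := MeasureTheory.integral_add_compl (measurableSet_Iic (a := x)) integrable_stdNormalPDF
  rw [Set.compl_Iic, integral_stdNormalPDF] at h2
  rw [h1, stdNormalCDF_eq]; linarith

lemma stdNormalCDF_zero : stdNormalCDF 0 = 1 / 2 := by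
  have := stdNormalCDF_neg 0
  rw [neg_zero] at this; linarith

lemma tendsto_stdNormalCDF_atTop : Tendsto stdNormalCDF atTop (𝓝 1) := by
  have := MeasureTheory.aecover_Iic (μ := MeasureTheory.volume) (tendsto_id (α := ℝ) (x := atTop))
  have := this.integral_tendsto_of_countably_generated integrable_stdNormalPDF
  rw [integral_stdNormalPDF] at this
  exact this

lemma tendsto_stdNormalCDF_atBot : Tendsto stdNormalCDF atBot (𝓝 0) := by
  have h := (tendsto_stdNormalCDF_atTop.comp tendsto_neg_atBot_atTop).const_sub 1
  simp only [sub_self] at h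
  refine h.congr fun x => ?_
  simp [stdNormalCDF_neg]

lemma stdNormalCDF_pos (x : ℝ) : 0 < stdNormalCDF x :=
  (strictMono_stdNormalCDF.monotone.le_of_tendsto tendsto_stdNormalCDF_atBot (x - 1)).trans_lt
    (strictMono_stdNormalCDF (by linarith))

lemma stdNormalCDF_lt_one (x : ℝ) : stdNormalCDF x < 1 := by
  have := stdNormalCDF_pos (-x)
  rw [stdNormalCDF_neg] at this; linarith

lemma exists_stdNormalCDF_eq {x : ℝ} (h0 : 0 < x) (h1 : x < 1) : ∃ u, stdNormalCDF u = x := by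
  obtain ⟨a, ha⟩ := (tendsto_stdNormalCDF_atBot.eventually (gt_mem_nhds h0)).exists
  obtain ⟨b, hb⟩ := (tendsto_stdNormalCDF_atTop.eventually (lt_mem_nhds h1)).exists
  exact mem_range_of_exists_le_of_exists_ge continuous_stdNormalCDF ⟨a, ha.le⟩ ⟨b, hb.le⟩

/-! ### The quantile function and the Gaussian isoperimetric profile. -/

/-- The quantile function of the standard normal distribution. -/
noncomputable def stdNormalQuantile : ℝ → ℝ := Function.invFun stdNormalCDF

lemma stdNormalQuantile_cdf (u : ℝ) : stdNormalQuantile (stdNormalCDF u) = u :=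
  Function.leftInverse_invFun strictMono_stdNormalCDF.injective u

lemma stdNormalCDF_quantile {x : ℝ} (h0 : 0 < x) (h1 : x < 1) :
    stdNormalCDF (stdNormalQuantile x) = x :=
  Function.invFun_eq (exists_stdNormalCDF_eq h0 h1)

lemma lt_stdNormalQuantile_iff {x u : ℝ} (h0 : 0 < x) (h1 : x < 1) :
    u < stdNormalQuantile x ↔ stdNormalCDF u < x := by
  rw [← strictMono_stdNormalCDF.lt_iff_lt, stdNormalCDF_quantile h0 h1]

lemma stdNormalQuantile_lt_iff {x u : ℝ} (h0 : 0 < x) (h1 : x < 1) :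
    stdNormalQuantile x < u ↔ x < stdNormalCDF u := by
  rw [← strictMono_stdNormalCDF.lt_iff_lt, stdNormalCDF_quantile h0 h1]

lemma continuousAt_stdNormalQuantile {x : ℝ} (h0 : 0 < x) (h1 : x < 1) :
    ContinuousAt stdNormalQuantile x := by
  have hI : ∀ᶠ y in 𝓝 x, 0 < y ∧ y < 1 := (lt_mem_nhds h0).and (gt_mem_nhds h1)
  refine tendsto_order.2 ⟨fun a ha => ?_, fun a ha => ?_⟩
  · rw [lt_stdNormalQuantile_iff h0 h1] at ha
    filter_upwards [hI, lt_mem_nhds ha] with y hy hay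
    rwa [lt_stdNormalQuantile_iff hy.1 hy.2]
  · rw [gt_iff_lt, stdNormalQuantile_lt_iff h0 h1] at ha
    filter_upwards [hI, gt_mem_nhds ha] with y hy hay
    rwa [stdNormalQuantile_lt_iff hy.1 hy.2]

lemma hasDerivAt_stdNormalQuantile {x : ℝ} (h0 : 0 < x) (h1 : x < 1) :
    HasDerivAt stdNormalQuantile (stdNormalPDF (stdNormalQuantile x))⁻¹ x :=
  HasDerivAt.of_local_left_inverse (continuousAt_stdNormalQuantile h0 h1)
    (hasDerivAt_stdNormalCDF _) (stdNormalPDF_pos _).ne'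
    (((lt_mem_nhds h0).and (gt_mem_nhds h1)).mono fun _ hy => stdNormalCDF_quantile hy.1 hy.2)

/-- The Gaussian isoperimetric profile `φ ∘ Φ⁻¹`, extended by zero outside `(0, 1)`. -/
noncomputable def gaussianProfile (x : ℝ) : ℝ :=
  if 0 < x ∧ x < 1 then stdNormalPDF (stdNormalQuantile x) else 0

lemma gaussianProfile_of_mem {x : ℝ} (h0 : 0 < x) (h1 : x < 1) :
    gaussianProfile x = stdNormalPDF (stdNormalQuantile x) := if_pos ⟨h0, h1⟩

lemma gaussianProfile_cdf (u : ℝ) : gaussianProfile (stdNormalCDF u) = stdNormalPDF u := by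
  rw [gaussianProfile_of_mem (stdNormalCDF_pos u) (stdNormalCDF_lt_one u), stdNormalQuantile_cdf]

lemma gaussianProfile_zero : gaussianProfile 0 = 0 := by simp [gaussianProfile]

lemma gaussianProfile_one : gaussianProfile 1 = 0 := by simp [gaussianProfile]

lemma gaussianProfile_nonneg (x : ℝ) : 0 ≤ gaussianProfile x := by
  unfold gaussianProfile
  split_ifs
  exacts [(stdNormalPDF_pos _).le, le_rfl]

lemma gaussianProfile_pos {x : ℝ} (h0 : 0 < x) (h1 : x < 1) : 0 < gaussianProfile x := by
  rw [gaussianProfile_of_mem h0 h1]; exact stdNormalPDF_pos _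

lemma gaussianProfile_one_sub (x : ℝ) : gaussianProfile (1 - x) = gaussianProfile x := by
  by_cases h : 0 < x ∧ x < 1
  · obtain ⟨u, rfl⟩ := exists_stdNormalCDF_eq h.1 h.2
    rw [← stdNormalCDF_neg, gaussianProfile_cdf, gaussianProfile_cdf, stdNormalPDF_neg]
  · rw [gaussianProfile, gaussianProfile, if_neg h, if_neg]
    rintro ⟨h1, h2⟩
    exact h ⟨by linarith, by linarith⟩

/-- The density cancels in the chain rule. Differentiating once more gives I'' = -1/I, the relation
behind the two-point inequality. -/
lemma hasDerivAt_gaussianProfile {x : ℝ} (h0 : 0 < x) (h1 : x < 1) :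
    HasDerivAt gaussianProfile (-stdNormalQuantile x) x := by
  have h := (hasDerivAt_stdNormalPDF (stdNormalQuantile x)).comp x
    (hasDerivAt_stdNormalQuantile h0 h1)
  rw [mul_assoc, mul_inv_cancel₀ (stdNormalPDF_pos _).ne', mul_one] at h
  refine h.congr_of_eventuallyEq ?_
  filter_upwards [lt_mem_nhds h0, gt_mem_nhds h1] with y hy hy'
  exact gaussianProfile_of_mem hy hy'

lemma stdNormalPDF_le_stdNormalPDF {u v : ℝ} (h : |v| ≤ |u|) :
    stdNormalPDF u ≤ stdNormalPDF v := by
  unfold stdNormalPDF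
  have := sq_le_sq.2 h
  gcongr

lemma tendsto_stdNormalPDF_atBot : Tendsto stdNormalPDF atBot (𝓝 0) := by
  have h : Tendsto (fun u : ℝ => u ^ 2 / 2) atBot atTop :=
    Tendsto.atTop_div_const two_pos (by simpa [Function.comp_def] using
      (tendsto_pow_atTop (α := ℝ) two_ne_zero).comp tendsto_neg_atBot_atTop)
  have := (Real.tendsto_exp_neg_atTop_nhds_zero.comp h).const_mul (1 / Real.sqrt (2 * Real.pi))
  rw [mul_zero] at this
  refine this.congr fun u => ?_
  simp [stdNormalPDF, neg_div]

lemma gaussianProfile_mono {x y : ℝ} (hx : 0 ≤ x) (hxy : x ≤ y) (hy : y ≤ 1 / 2) :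
    gaussianProfile x ≤ gaussianProfile y := by
  rcases hx.eq_or_lt with rfl | hx
  · rw [gaussianProfile_zero]; exact gaussianProfile_nonneg _
  obtain ⟨u, rfl⟩ := exists_stdNormalCDF_eq hx (by linarith)
  obtain ⟨v, rfl⟩ := exists_stdNormalCDF_eq (hx.trans_le hxy) (by linarith)
  rw [← stdNormalCDF_zero] at hy
  have h1 := strictMono_stdNormalCDF.le_iff_le.1 hxy
  have h2 := strictMono_stdNormalCDF.le_iff_le.1 hy
  rw [gaussianProfile_cdf, gaussianProfile_cdf]
  apply stdNormalPDF_le_stdNormalPDF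
  rw [abs_of_nonpos h2, abs_of_nonpos (h1.trans h2)]
  linarith

lemma gaussianProfile_anti {x y : ℝ} (hx : 1 / 2 ≤ x) (hxy : x ≤ y) (hy : y ≤ 1) :
    gaussianProfile y ≤ gaussianProfile x := by
  rw [← gaussianProfile_one_sub x, ← gaussianProfile_one_sub y]
  exact gaussianProfile_mono (by linarith) (by linarith) (by linarith)

lemma continuousAt_gaussianProfile_zero : ContinuousAt gaussianProfile 0 := by
  rw [ContinuousAt, gaussianProfile_zero]
  refine tendsto_order.2 ⟨fun a ha => Eventually.of_forall fun x =>
    ha.trans_le (gaussianProfile_nonneg x), fun a ha => ?_⟩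
  obtain ⟨u, hu⟩ := ((tendsto_stdNormalPDF_atBot.eventually (gt_mem_nhds ha)).and
    (eventually_le_atBot 0)).exists
  filter_upwards [gt_mem_nhds (stdNormalCDF_pos u)] with x hx
  rcases le_or_gt x 0 with h | h
  · rwa [gaussianProfile, if_neg (fun h' => h.not_gt h'.1)]
  · refine (gaussianProfile_mono h.le hx.le ?_).trans_lt ((gaussianProfile_cdf u).trans_lt hu.1)
    rw [← stdNormalCDF_zero]
    exact strictMono_stdNormalCDF.monotone hu.2

lemma continuousAt_gaussianProfile {x : ℝ} (h0 : 0 ≤ x) (h1 : x ≤ 1) :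
    ContinuousAt gaussianProfile x := by
  rcases h0.eq_or_lt with rfl | h0
  · exact continuousAt_gaussianProfile_zero
  rcases h1.eq_or_lt with rfl | h1
  · have h : ContinuousAt (fun x : ℝ => gaussianProfile (1 - x)) 1 := by
      have h0 : ContinuousAt gaussianProfile (1 - 1) := by
        simpa using continuousAt_gaussianProfile_zero
      exact h0.comp (f := fun x : ℝ => 1 - x) (by fun_prop)
    simpa only [gaussianProfile_one_sub] using h
  · exact (hasDerivAt_gaussianProfile h0 h1).continuousAt

/-! ### The two-point inequality. -/

/-- A function has no local minimum at a critical point with negative second derivative. -/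
lemma not_isLocalMin_of_hasDerivAt {D D' : ℝ → ℝ} {D'' p : ℝ}
    (h1 : ∀ᶠ x in 𝓝 p, HasDerivAt D (D' x) x) (h2 : HasDerivAt D' D'' p) (hneg : D'' < 0) :
    ¬ IsLocalMin D p := by
  intro hmin
  have hd : deriv D =ᶠ[𝓝 p] D' := h1.mono fun x hx => hx.deriv
  have hdd : HasDerivAt (deriv D) D'' p := h2.congr_of_eventuallyEq hd
  -- The second-derivative test makes `p` a local maximum too, so `D` is locally constant and its
  -- second derivative vanishes, a contradiction.
  have hmax := isLocalMax_of_deriv_deriv_neg (f := D) (x₀ := p) (by rwa [hdd.deriv])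
    hmin.deriv_eq_zero h1.self_of_nhds.continuousAt
  have hconst : D =ᶠ[𝓝 p] fun _ => D p :=
    hmax.mp (hmin.mono fun x h h' => le_antisymm h' h)
  have h0 : deriv D =ᶠ[𝓝 p] fun _ => 0 := by simpa using hconst.deriv
  have := h0.deriv_eq
  rw [hdd.deriv] at this
  simp at this
  linarith

/-- This is the induction step of the isoperimetric inequality. Only the term at `b` carries a
gradient, because pivotality is counted only at points of the set. As a function of the weight q,
right side minus left side vanishes at q = 0 and q = 1, and it is strictly concave wherever it is
negative; hence it has no negative minimum. -/
lemma gaussianProfile_two_point {a b p : ℝ} (ha : 0 ≤ a) (hab : a ≤ b) (hb : b ≤ 1)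
    (hp0 : 0 < p) (hp1 : p < 1) :
    gaussianProfile (p * b + (1 - p) * a) ≤
      p * Real.sqrt (gaussianProfile b ^ 2 + 4 * -Real.log p * (b - a) ^ 2)
        + (1 - p) * gaussianProfile a := by
  rcases hab.eq_or_lt with rfl | hab
  · have h : p * a + (1 - p) * a = a := by ring
    have h' := Real.sqrt_sq (gaussianProfile_nonneg a)
    simp only [sub_self, ne_eq, OfNat.ofNat_ne_zero, not_false_eq_true, zero_pow, mul_zero,
      add_zero, h, h']
    linarith
  set d := b - a with hd
  have hd0 : 0 < d := by linarith
  set B := gaussianProfile b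
  set A := gaussianProfile a
  set R : ℝ → ℝ := fun q => Real.sqrt (B ^ 2 + 4 * -Real.log q * d ^ 2) with hR
  set D : ℝ → ℝ := fun q => q * R q + (1 - q) * A - gaussianProfile (a + q * d) with hD
  have hmem : ∀ q, 0 < q → q < 1 → 0 < a + q * d ∧ a + q * d < 1 := fun q h0 h1 =>
    ⟨by positivity, by nlinarith⟩
  have hrad : ∀ q, 0 < q → q < 1 → 0 < B ^ 2 + 4 * -Real.log q * d ^ 2 := fun q h0 h1 => by
    have := Real.log_neg h0 h1
    have : 0 < -Real.log q := by linarith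
    positivity
  have hRpos : ∀ q, 0 < q → q < 1 → 0 < R q := fun q h0 h1 => Real.sqrt_pos.2 (hrad q h0 h1)
  have hR' : ∀ q, 0 < q → q < 1 → HasDerivAt R (-(2 * d ^ 2) / (q * R q)) q := fun q h0 h1 => by
    have h := ((((Real.hasDerivAt_log h0.ne').neg.const_mul 4).mul_const (d ^ 2)).const_add
      (B ^ 2)).sqrt (hrad q h0 h1).ne'
    refine HasDerivAt.congr_deriv h ?_
    have := hRpos q h0 h1
    change _ / (2 * R q) = _
    field_simp
    ring
  set D' : ℝ → ℝ := fun q => R q - 2 * d ^ 2 / R q - A + stdNormalQuantile (a + q * d) * d with hD'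
  have h1 : ∀ q, 0 < q → q < 1 → HasDerivAt D (D' q) q := fun q hq0 hq1 => by
    have e1 := (hasDerivAt_id q).mul (hR' q hq0 hq1)
    have e2 := ((hasDerivAt_id q).const_sub 1).mul_const A
    have e3 := (hasDerivAt_gaussianProfile (hmem q hq0 hq1).1 (hmem q hq0 hq1).2).comp q
      (((hasDerivAt_id q).mul_const d).const_add a)
    refine HasDerivAt.congr_deriv ((e1.add e2).sub e3) ?_
    have := hRpos q hq0 hq1
    simp only [hD', id]
    field_simp
    ring
  have h2 : ∀ q, 0 < q → q < 1 → HasDerivAt D'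
      (-(2 * d ^ 2) / (q * R q) * (1 + 2 * d ^ 2 / R q ^ 2) +
        d ^ 2 / gaussianProfile (a + q * d)) q := fun q hq0 hq1 => by
    have hr := hRpos q hq0 hq1
    have e1 := (hR' q hq0 hq1)
    have e2 := (hasDerivAt_const q (2 * d ^ 2)).div e1 hr.ne'
    have e3 := ((hasDerivAt_stdNormalQuantile (hmem q hq0 hq1).1 (hmem q hq0 hq1).2).comp q
      (((hasDerivAt_id q).mul_const d).const_add a)).mul_const d
    rw [← gaussianProfile_of_mem (hmem q hq0 hq1).1 (hmem q hq0 hq1).2] at e3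
    refine HasDerivAt.congr_deriv (((e1.sub e2).sub_const A).add e3) ?_
    have hg := gaussianProfile_pos (hmem q hq0 hq1).1 (hmem q hq0 hq1).2
    field_simp
    ring
  -- The logarithm is singular at q = 0; moving the factor q under the root leaves only q log q,
  -- which is continuous there.
  have hcont : ContinuousOn D (Set.Icc 0 1) := by
    have e1 : ContinuousOn (fun q : ℝ => Real.sqrt (q ^ 2 * B ^ 2 + 4 * (-(q * Real.log q) * q) *
        d ^ 2) + (1 - q) * A) (Set.Icc 0 1) := by
      have := Real.continuous_mul_log
      exact Continuous.continuousOn (by fun_prop)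
    have e2 : ContinuousOn (fun q : ℝ => gaussianProfile (a + q * d)) (Set.Icc 0 1) := by
      intro q hq
      refine (ContinuousAt.comp (f := fun q : ℝ => a + q * d) (continuousAt_gaussianProfile ?_ ?_)
        (by fun_prop)).continuousWithinAt
      · have := hq.1; positivity
      · nlinarith [hq.1, hq.2]
    refine (e1.sub e2).congr fun q hq => ?_
    simp only [hD, hR]
    congr 2
    rw [← Real.sqrt_sq hq.1, ← Real.sqrt_mul (by positivity), Real.sqrt_sq hq.1]
    congr 1; ring
  suffices h : 0 ≤ D p by
    have e : p * b + (1 - p) * a = a + p * d := by rw [hd]; ring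
    rw [e]
    simp only [hD] at h
    linarith
  by_contra! hneg
  obtain ⟨q, hq, hmin⟩ := isCompact_Icc.exists_isMinOn (Set.nonempty_Icc.2 zero_le_one) hcont
  have hDq : D q < 0 := (hmin ⟨hp0.le, hp1.le⟩).trans_lt hneg
  have hq0 : 0 < q := by
    refine hq.1.lt_of_ne ?_
    rintro rfl
    simp [hD, A] at hDq
  have hq1 : q < 1 := by
    refine hq.2.lt_of_ne ?_
    rintro rfl
    have hB : Real.sqrt (B ^ 2) = B := Real.sqrt_sq (gaussianProfile_nonneg b)
    simp [hD, hR, hd, hB, B] at hDq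
  have hloc : IsLocalMin D q := hmin.isLocalMin (Icc_mem_nhds hq0 hq1)
  refine not_isLocalMin_of_hasDerivAt ?_ (h2 q hq0 hq1) ?_ hloc
  · filter_upwards [lt_mem_nhds hq0, gt_mem_nhds hq1] with x hx hx'
    exact h1 x hx hx'
  · have hr := hRpos q hq0 hq1
    have hA : 0 ≤ (1 - q) * A := mul_nonneg (by linarith) (gaussianProfile_nonneg a)
    -- Negativity of `D q` bounds the profile below by q R(q), so the positive term of D'' is less
    -- than d²/(q R), while the negative term is at least twice that in size.
    have hlt : q * R q < gaussianProfile (a + q * d) := by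
      simp only [hD] at hDq; linarith
    have hqR : 0 < q * R q := mul_pos hq0 hr
    have k1 : d ^ 2 / gaussianProfile (a + q * d) < d ^ 2 / (q * R q) := by gcongr
    have k2 : 0 < d ^ 2 / (q * R q) := by positivity
    have k3 : 0 ≤ 2 * d ^ 2 / R q ^ 2 := by positivity
    have k4 : -(2 * d ^ 2) / (q * R q) = -(2 * (d ^ 2 / (q * R q))) := by ring
    rw [k4]
    nlinarith [mul_nonneg k2.le k3]

/-! ### Expectations under product Bernoulli measures. -/

/-- Expectation of `F` under the product of `n` Bernoulli measures with parameter `p`. -/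
noncomputable def bernoulliExp {n : ℕ} (p : ℝ) (F : (Fin n → Bool) → ℝ) : ℝ :=
  ∑ x, (∏ i, if x i then p else 1 - p) * F x

lemma bernoulliExp_zero (p : ℝ) (F : (Fin 0 → Bool) → ℝ) :
    bernoulliExp p F = F default := by
  simp only [bernoulliExp, Finset.univ_eq_empty, Finset.prod_empty, one_mul]
  exact (Fintype.sum_unique F).trans (congrArg F (Subsingleton.elim _ _))

lemma bernoulliExp_succ {n : ℕ} (p : ℝ) (F : (Fin (n + 1) → Bool) → ℝ) :
    bernoulliExp p F = p * bernoulliExp p (fun x => F (Fin.cons true x)) +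
      (1 - p) * bernoulliExp p (fun x => F (Fin.cons false x)) := by
  unfold bernoulliExp
  rw [← (Fin.consEquiv fun _ : Fin (n + 1) => Bool).sum_comp, Fintype.sum_prod_type]
  simp [Fin.consEquiv, Fin.prod_univ_succ, Finset.mul_sum, mul_assoc]

lemma bernoulliExp_add {n : ℕ} (p : ℝ) (F G : (Fin n → Bool) → ℝ) :
    bernoulliExp p (fun x => F x + G x) = bernoulliExp p F + bernoulliExp p G := by
  simp [bernoulliExp, mul_add, Finset.sum_add_distrib]

lemma bernoulliExp_const_mul {n : ℕ} (p c : ℝ) (F : (Fin n → Bool) → ℝ) :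
    bernoulliExp p (fun x => c * F x) = c * bernoulliExp p F := by
  simp [bernoulliExp, Finset.mul_sum, mul_left_comm]

lemma bernoulliExp_sub {n : ℕ} (p : ℝ) (F G : (Fin n → Bool) → ℝ) :
    bernoulliExp p (fun x => F x - G x) = bernoulliExp p F - bernoulliExp p G := by
  simp [bernoulliExp, mul_sub, Finset.sum_sub_distrib]

lemma bernoulliExp_sum {n : ℕ} {ι : Type*} (s : Finset ι) (p : ℝ) (F : ι → (Fin n → Bool) → ℝ) :
    bernoulliExp p (fun x => ∑ c ∈ s, F c x) = ∑ c ∈ s, bernoulliExp p (F c) := by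
  simp only [bernoulliExp, Finset.mul_sum]
  exact Finset.sum_comm

lemma bernoulliExp_mono {n : ℕ} {p : ℝ} (h0 : 0 ≤ p) (h1 : p ≤ 1) {F G : (Fin n → Bool) → ℝ}
    (h : ∀ x, F x ≤ G x) : bernoulliExp p F ≤ bernoulliExp p G := by
  refine Finset.sum_le_sum fun x _ => mul_le_mul_of_nonneg_left (h x) ?_
  refine Finset.prod_nonneg fun i _ => ?_
  split_ifs <;> linarith

lemma bernoulliExp_const {n : ℕ} (p c : ℝ) :
    bernoulliExp p (fun _ : Fin n → Bool => c) = c := by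
  induction n with
  | zero => exact bernoulliExp_zero p _
  | succ n ih => rw [bernoulliExp_succ, ih]; ring

/-- Minkowski's inequality for the pair `(u, v)` with the Euclidean norm. -/
lemma sqrt_bernoulliExp_le {n : ℕ} {p : ℝ} (h0 : 0 ≤ p) (h1 : p ≤ 1)
    (u v : (Fin n → Bool) → ℝ) :
    Real.sqrt (bernoulliExp p u ^ 2 + bernoulliExp p v ^ 2) ≤
      bernoulliExp p (fun x => Real.sqrt (u x ^ 2 + v x ^ 2)) := by
  have key : ∀ a b c d : ℝ, Real.sqrt ((a + c) ^ 2 + (b + d) ^ 2) ≤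
      Real.sqrt (a ^ 2 + b ^ 2) + Real.sqrt (c ^ 2 + d ^ 2) := fun a b c d => by
    have h := norm_add_le (⟨a, b⟩ : ℂ) ⟨c, d⟩
    simpa [Complex.norm_eq_sqrt_sq_add_sq] using h
  have scale : ∀ t a b : ℝ, 0 ≤ t →
      Real.sqrt ((t * a) ^ 2 + (t * b) ^ 2) = t * Real.sqrt (a ^ 2 + b ^ 2) := fun t a b ht => by
    rw [mul_pow, mul_pow, ← mul_add, Real.sqrt_mul (by positivity), Real.sqrt_sq ht]
  induction n with
  | zero => simp [bernoulliExp_zero]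
  | succ n ih =>
    rw [bernoulliExp_succ p u, bernoulliExp_succ p v, bernoulliExp_succ]
    refine (key _ _ _ _).trans ?_
    rw [scale _ _ _ h0, scale _ _ _ (by linarith)]
    have hq : 0 ≤ 1 - p := by linarith
    gcongr
    · exact ih _ _
    · exact ih _ _

/-! ### Pivotal coordinates, the Margulis–Russo formula and isoperimetry on the cube. -/

open Classical in
/-- The Bernoulli measure of a set of the discrete cube. -/
noncomputable def bernoulliProb {n : ℕ} (p : ℝ) (S : Set (Fin n → Bool)) : ℝ :=
  bernoulliExp p fun x => if x ∈ S then 1 else 0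

/-- The coordinates that are pivotal for `S` at the point `x` of `S`. -/
def pivotal {n : ℕ} (S : Set (Fin n → Bool)) (x : Fin n → Bool) : Set (Fin n) :=
  {i | x ∈ S ∧ Function.update x i false ∉ S}

lemma bernoulliProb_nonneg {n : ℕ} {p : ℝ} (h0 : 0 ≤ p) (h1 : p ≤ 1) (S : Set (Fin n → Bool)) :
    0 ≤ bernoulliProb p S := by
  rw [← bernoulliExp_const (n := n) p 0]
  exact bernoulliExp_mono h0 h1 fun x => by positivity

lemma bernoulliProb_le_one {n : ℕ} {p : ℝ} (h0 : 0 ≤ p) (h1 : p ≤ 1) (S : Set (Fin n → Bool)) :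
    bernoulliProb p S ≤ 1 := by
  rw [← bernoulliExp_const (n := n) p 1]
  exact bernoulliExp_mono h0 h1 fun x => by split_ifs <;> norm_num

/-- The section of a set of the discrete cube at the first coordinate. -/
def cubeSection {n : ℕ} (S : Set (Fin (n + 1) → Bool)) (b : Bool) : Set (Fin n → Bool) :=
  {x | (Fin.cons b x : Fin (n + 1) → Bool) ∈ S}

lemma bernoulliProb_succ {n : ℕ} (p : ℝ) (S : Set (Fin (n + 1) → Bool)) :
    bernoulliProb p S = p * bernoulliProb p (cubeSection S true) +
      (1 - p) * bernoulliProb p (cubeSection S false) := by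
  unfold bernoulliProb
  rw [bernoulliExp_succ]
  rfl

lemma isUpperSet_cubeSection {n : ℕ} {S : Set (Fin (n + 1) → Bool)} (hS : IsUpperSet S)
    (b : Bool) : IsUpperSet (cubeSection S b) := fun _ _ hxy hx =>
  hS (Fin.cons_le_cons.2 ⟨le_rfl, hxy⟩) hx

lemma cubeSection_subset {n : ℕ} {S : Set (Fin (n + 1) → Bool)} (hS : IsUpperSet S) :
    cubeSection S false ⊆ cubeSection S true := fun _ hx =>
  hS (Fin.cons_le_cons.2 ⟨Bool.false_le _, le_rfl⟩) hx

lemma ncard_pivotal_eq_sum {n : ℕ} (S : Set (Fin n → Bool)) (x : Fin n → Bool)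
    [∀ i, Decidable (x ∈ S ∧ Function.update x i false ∉ S)] :
    (pivotal S x).ncard = ∑ i, if x ∈ S ∧ Function.update x i false ∉ S then 1 else 0 := by
  rw [← Finset.card_filter, ← Set.ncard_coe_finset]
  congr 1; ext i; simp [pivotal]

-- The indicator counts the new coordinate itself. When that coordinate is false, resetting it
-- changes nothing, so the companion formula has no extra term.
open Classical in
lemma ncard_pivotal_cons_true {n : ℕ} (S : Set (Fin (n + 1) → Bool)) (x : Fin n → Bool) :
    (pivotal S (Fin.cons true x)).ncard = (pivotal (cubeSection S true) x).ncard +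
      if x ∈ cubeSection S true ∧ x ∉ cubeSection S false then 1 else 0 := by
  rw [ncard_pivotal_eq_sum, ncard_pivotal_eq_sum, Fin.sum_univ_succ, add_comm]
  simp only [cubeSection, Set.mem_ofPred_eq, Fin.cons_update, Fin.update_cons_zero]
  congr

lemma ncard_pivotal_cons_false {n : ℕ} (S : Set (Fin (n + 1) → Bool)) (x : Fin n → Bool) :
    (pivotal S (Fin.cons false x)).ncard = (pivotal (cubeSection S false) x).ncard := by
  classical
  rw [ncard_pivotal_eq_sum, ncard_pivotal_eq_sum, Fin.sum_univ_succ]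
  simp [cubeSection]

open Classical in
lemma bernoulliExp_sdiff {n : ℕ} (p : ℝ) {S T : Set (Fin n → Bool)} (h : T ⊆ S) :
    bernoulliExp p (fun x => if x ∈ S ∧ x ∉ T then (1 : ℝ) else 0) =
      bernoulliProb p S - bernoulliProb p T := by
  rw [bernoulliProb, bernoulliProb, ← bernoulliExp_sub]
  congr 1; ext x
  by_cases hT : x ∈ T
  · simp [hT, h hT]
  · simp [hT]

/-- The Margulis–Russo formula. -/
lemma hasDerivAt_bernoulliProb {n : ℕ} {S : Set (Fin n → Bool)} (hS : IsUpperSet S) {p : ℝ}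
    (hp : p ≠ 0) :
    HasDerivAt (fun q => bernoulliProb q S)
      (bernoulliExp p (fun x => ((pivotal S x).ncard : ℝ)) / p) p := by
  classical
  induction n with
  | zero =>
    have h : (fun q => bernoulliProb q S) = fun _ => if default ∈ S then 1 else 0 := by
      ext q; rw [bernoulliProb, bernoulliExp_zero]
    rw [h, bernoulliExp_zero]
    refine HasDerivAt.congr_deriv (hasDerivAt_const p _) ?_
    simp [ncard_pivotal_eq_sum]
  | succ n ih =>
    have e1 := (hasDerivAt_id p).mul (ih (isUpperSet_cubeSection hS true))
    have e2 := ((hasDerivAt_id p).const_sub 1).mul (ih (isUpperSet_cubeSection hS false))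
    have h : (fun q => bernoulliProb q S) = fun q => q * bernoulliProb q (cubeSection S true) +
      (1 - q) * bernoulliProb q (cubeSection S false) := by
      ext q; rw [bernoulliProb_succ]
    rw [h]
    refine HasDerivAt.congr_deriv (e1.add e2) ?_
    rw [bernoulliExp_succ]
    simp only [ncard_pivotal_cons_true, ncard_pivotal_cons_false, Nat.cast_add, Nat.cast_ite,
      Nat.cast_one, Nat.cast_zero]
    rw [bernoulliExp_add, bernoulliExp_sdiff p (cubeSection_subset hS)]
    simp only [id]
    field_simp
    ring

/-- The Gaussian isoperimetric inequality for increasing sets of the biased discrete cube. -/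
lemma gaussianProfile_bernoulliProb_le {n : ℕ} {S : Set (Fin n → Bool)} (hS : IsUpperSet S) {p : ℝ}
    (hp0 : 0 < p) (hp1 : p < 1) :
    gaussianProfile (bernoulliProb p S) ≤ 2 * Real.sqrt (-Real.log p) *
      bernoulliExp p (fun x => Real.sqrt (pivotal S x).ncard) := by
  classical
  have hl : 0 ≤ -Real.log p := by linarith [Real.log_neg hp0 hp1]
  set c := 2 * Real.sqrt (-Real.log p) with hc
  have hc0 : 0 ≤ c := by positivity
  have hc2 : 4 * -Real.log p = c ^ 2 := by rw [hc, mul_pow, Real.sq_sqrt hl]; ring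
  induction n with
  | zero =>
    rw [bernoulliProb, bernoulliExp_zero, bernoulliExp_zero]
    refine le_trans (le_of_eq ?_) (by positivity)
    split_ifs
    exacts [gaussianProfile_one, gaussianProfile_zero]
  | succ n ih =>
    set S1 := cubeSection S true
    set S0 := cubeSection S false
    have hsub : S0 ⊆ S1 := cubeSection_subset hS
    have i1 := ih (isUpperSet_cubeSection hS true)
    have i0 := ih (isUpperSet_cubeSection hS false)
    have hle : bernoulliProb p S0 ≤ bernoulliProb p S1 :=
      bernoulliExp_mono hp0.le hp1.le fun x => by
        by_cases hx : x ∈ S0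
        · simp [hx, hsub hx]
        · simp only [hx, if_false]; positivity
    have h2 := gaussianProfile_two_point (bernoulliProb_nonneg hp0.le hp1.le S0) hle
      (bernoulliProb_le_one hp0.le hp1.le S1) hp0 hp1
    rw [bernoulliProb_succ, bernoulliExp_succ]
    simp only [ncard_pivotal_cons_true, ncard_pivotal_cons_false]
    refine h2.trans ?_
    -- The induction hypothesis bounds the profile of `S1`. Minkowski then applies to the pair of √h
    -- and the indicator of `S1` minus `S0`, whose squares add up to the pivotal count in the larger
    -- cube.
    have key : Real.sqrt (gaussianProfile (bernoulliProb p S1) ^ 2 +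
        4 * -Real.log p * (bernoulliProb p S1 - bernoulliProb p S0) ^ 2) ≤
        c * bernoulliExp p (fun x => Real.sqrt (((pivotal S1 x).ncard +
          if x ∈ S1 ∧ x ∉ S0 then 1 else 0 : ℕ) : ℝ)) := by
      calc _ ≤ Real.sqrt (c ^ 2 * (bernoulliExp p (fun x => Real.sqrt (pivotal S1 x).ncard) ^ 2 +
              (bernoulliProb p S1 - bernoulliProb p S0) ^ 2)) := by
            apply Real.sqrt_le_sqrt
            rw [hc2, mul_add]
            have := gaussianProfile_nonneg (bernoulliProb p S1)
            gcongr
            rw [← mul_pow]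
            gcongr
        _ = c * Real.sqrt (bernoulliExp p (fun x => Real.sqrt (pivotal S1 x).ncard) ^ 2 +
              (bernoulliProb p S1 - bernoulliProb p S0) ^ 2) := by
            rw [Real.sqrt_mul (by positivity), Real.sqrt_sq hc0]
        _ ≤ _ := by
            rw [← bernoulliExp_sdiff p hsub]
            refine mul_le_mul_of_nonneg_left ((sqrt_bernoulliExp_le hp0.le hp1.le _ _).trans
              (le_of_eq ?_)) hc0
            congr 1; ext x
            rw [Real.sq_sqrt (by positivity)]
            split_ifs <;> simp
    have hq : 0 ≤ 1 - p := by linarith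
    calc _ ≤ p * (c * bernoulliExp p (fun x => Real.sqrt (((pivotal S1 x).ncard +
          if x ∈ S1 ∧ x ∉ S0 then 1 else 0 : ℕ) : ℝ))) +
          (1 - p) * (c * bernoulliExp p (fun x => Real.sqrt (pivotal S0 x).ncard)) := by
          gcongr
      _ = _ := by ring

/-! ### Uncorrectable erasure patterns and codewords of small weight. -/

lemma bernoulliExp_prod {n : ℕ} (p : ℝ) (g : Fin n → Bool → ℝ) :
    bernoulliExp p (fun x => ∏ i, g i (x i)) = ∏ i, (p * g i true + (1 - p) * g i false) := by
  induction n with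
  | zero => simp [bernoulliExp_zero]
  | succ n ih =>
    rw [bernoulliExp_succ, Fin.prod_univ_succ]
    simp only [Fin.prod_univ_succ, Fin.cons_zero, Fin.cons_succ]
    rw [bernoulliExp_const_mul, bernoulliExp_const_mul, ih fun i => g i.succ]
    ring

/-- The probability that a random set contains a given set `s`. -/
lemma bernoulliExp_superset {n : ℕ} (p : ℝ) (s : Finset (Fin n)) :
    bernoulliExp p (fun x => if ∀ i ∈ s, x i = true then (1 : ℝ) else 0) = p ^ s.card := by
  have h : (fun x : Fin n → Bool => if ∀ i ∈ s, x i = true then (1 : ℝ) else 0) =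
      fun x => ∏ i, (if i ∈ s then (if x i = true then (1 : ℝ) else 0) else 1) := by
    ext x
    rw [Finset.prod_ite_mem, Finset.univ_inter, Finset.prod_boole]
    congr
  rw [h, bernoulliExp_prod p fun i b => if i ∈ s then (if b = true then (1 : ℝ) else 0) else 1]
  have h2 : ∀ i, p * (if i ∈ s then (if true = true then (1 : ℝ) else 0) else 1) +
      (1 - p) * (if i ∈ s then (if false = true then (1 : ℝ) else 0) else 1) =
      if i ∈ s then p else 1 := fun i => by split_ifs <;> simp_all
  rw [Finset.prod_congr rfl fun i _ => h2 i, Finset.prod_ite_mem]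
  simp

/-- The erasure patterns that contain the support of some nonzero codeword. -/
def uncorrectable {N : ℕ} (C : Submodule (ZMod 2) (Fin N → ZMod 2)) : Set (Fin N → Bool) :=
  {e | ∃ c ∈ C, c ≠ 0 ∧ ∀ i, c i ≠ 0 → e i = true}

lemma isUpperSet_uncorrectable {N : ℕ} (C : Submodule (ZMod 2) (Fin N → ZMod 2)) :
    IsUpperSet (uncorrectable C) := by
  rintro e e' hee ⟨c, hc, hc0, h⟩
  refine ⟨c, hc, hc0, fun i hi => ?_⟩
  have := hee i
  rw [h i hi] at this
  exact top_le_iff.1 this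

/-- Every nonzero codeword supported in the erased set must be 1 at each pivotal coordinate. Two
distinct ones would sum to a nonzero codeword vanishing at a pivotal `i`, which is impossible. So
there is only one, and un-erasing any point of its support destroys the event. -/
lemma exists_hammingNorm_eq_ncard_pivotal {N : ℕ} (C : Submodule (ZMod 2) (Fin N → ZMod 2))
    {e : Fin N → Bool} (he : (pivotal (uncorrectable C) e).Nonempty) :
    ∃ c ∈ C, c ≠ 0 ∧ (∀ i, c i ≠ 0 → e i = true) ∧
      hammingNorm c = (pivotal (uncorrectable C) e).ncard := by
  obtain ⟨i, ⟨c, hc, hc0, hce⟩, hi⟩ := he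
  have hpiv : ∀ j, Function.update e j false ∉ uncorrectable C →
      ∀ c' ∈ C, c' ≠ 0 → (∀ k, c' k ≠ 0 → e k = true) → c' j ≠ 0 := by
    intro j hj c' hc' hc'0 hc'e hj0
    refine hj ⟨c', hc', hc'0, fun k hk => ?_⟩
    rw [Function.update_of_ne (by rintro rfl; exact hk hj0)]
    exact hc'e k hk
  refine ⟨c, hc, hc0, hce, ?_⟩
  rw [hammingNorm, ← Set.ncard_coe_finset]
  congr 1
  ext j
  simp only [Finset.coe_filter, Finset.mem_univ, true_and, pivotal, Set.mem_ofPred_eq]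
  refine ⟨fun hj => ⟨⟨c, hc, hc0, hce⟩, ?_⟩, fun hj => hpiv j hj.2 c hc hc0 hce⟩
  rintro ⟨c', hc', hc'0, hc'e⟩
  have hsupp : ∀ k, c' k ≠ 0 → k ≠ j ∧ e k = true := fun k hk => by
    have := hc'e k hk
    by_cases hkj : k = j
    · subst hkj; simp at this
    · exact ⟨hkj, by rwa [Function.update_of_ne hkj] at this⟩
  have hj' : c' j = 0 := by
    by_contra h
    exact (hsupp j h).1 rfl
  have hone : ∀ z : ZMod 2, z ≠ 0 → z = 1 := by decide
  have h1 := hone _ (hpiv i hi c hc hc0 hce)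
  have h2 := hone _ (hpiv i hi c' hc' hc'0 fun k hk => (hsupp k hk).2)
  -- The sum is nonzero at `j`, lies in the erased set, and equals 1 + 1 = 0 at `i`, contradicting
  -- the pivotality of `i`.
  refine hpiv i hi (c + c') (C.add_mem hc hc') ?_ ?_ ?_
  · intro h
    have := congrFun h j
    simp only [Pi.add_apply, hj', add_zero, Pi.zero_apply] at this
    exact hj this
  · intro k hk
    by_contra hek
    have e1 : c k = 0 := by
      by_contra h; exact hek (hce k h)
    have e2 : c' k = 0 := by
      by_contra h; exact hek (hsupp k h).2
    simp [e1, e2] at hk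
  · rw [Pi.add_apply, h1, h2]; decide

/-- This is a union bound: a pattern with 0 < h ≤ W contains the support of a codeword of weight h,
and a given support of size w is erased with probability p^w. -/
lemma bernoulliExp_sqrt_pivotal_le {N : ℕ} (C : Submodule (ZMod 2) (Fin N → ZMod 2)) (W : ℕ)
    {p : ℝ} (h0 : 0 ≤ p) (h1 : p ≤ 1) :
    bernoulliExp p (fun e => if (pivotal (uncorrectable C) e).ncard ≤ W then
      Real.sqrt (pivotal (uncorrectable C) e).ncard else 0) ≤
    ∑ w ∈ Finset.Icc 1 W, Real.sqrt w * weightDistribution C w * p ^ w := by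
  classical
  set T : Finset (Fin N → ZMod 2) :=
    Finset.univ.filter fun c => c ∈ C ∧ c ≠ 0 ∧ hammingNorm c ≤ W with hT
  have hpt : ∀ e : Fin N → Bool, (if (pivotal (uncorrectable C) e).ncard ≤ W then
      Real.sqrt (pivotal (uncorrectable C) e).ncard else 0) ≤
      ∑ c ∈ T, Real.sqrt (hammingNorm c) *
        if ∀ i ∈ Finset.univ.filter (fun i => c i ≠ 0), e i = true then (1 : ℝ) else 0 := by
    intro e
    have hnn : ∀ c ∈ T, 0 ≤ Real.sqrt (hammingNorm c) *
        if ∀ i ∈ Finset.univ.filter (fun i => c i ≠ 0), e i = true then (1 : ℝ) else 0 :=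
      fun c _ => by positivity
    split_ifs with hW
    · rcases (pivotal (uncorrectable C) e).eq_empty_or_nonempty with he | he
      · rw [he]
        simpa using Finset.sum_nonneg hnn
      · obtain ⟨c, hc, hc0, hce, hwt⟩ := exists_hammingNorm_eq_ncard_pivotal C he
        have hcT : c ∈ T := by
          rw [hT, Finset.mem_filter]
          exact ⟨Finset.mem_univ _, hc, hc0, hwt.trans_le hW⟩
        refine le_trans (le_of_eq ?_) (Finset.single_le_sum hnn hcT)
        rw [if_pos (by simpa using hce), hwt, mul_one]
    · exact Finset.sum_nonneg hnn
  refine (bernoulliExp_mono h0 h1 hpt).trans (le_of_eq ?_)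
  rw [bernoulliExp_sum]
  have hmaps : ∀ c ∈ T, hammingNorm c ∈ Finset.Icc 1 W := fun c hc => by
    rw [hT, Finset.mem_filter] at hc
    exact Finset.mem_Icc.2 ⟨hammingNorm_pos_iff.2 hc.2.2.1, hc.2.2.2⟩
  rw [← Finset.sum_fiberwise_of_maps_to hmaps]
  refine Finset.sum_congr rfl fun w hw => ?_
  have hcard : weightDistribution C w = (T.filter fun c => hammingNorm c = w).card := by
    rw [weightDistribution, ← Set.ncard_coe_finset]
    congr 1
    ext c
    simp only [hT, Finset.coe_filter, Finset.mem_filter, Finset.mem_univ, true_and,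
      Set.mem_ofPred_eq]
    refine ⟨fun h => ⟨⟨h.1, ?_, ?_⟩, h.2⟩, fun h => ⟨h.1.1, h.2⟩⟩
    · rw [← hammingNorm_pos_iff, h.2]
      exact (Finset.mem_Icc.1 hw).1
    · rw [h.2]; exact (Finset.mem_Icc.1 hw).2
  rw [hcard, mul_right_comm, mul_comm, ← nsmul_eq_mul]
  refine Finset.sum_eq_card_nsmul fun c hc => ?_
  rw [bernoulliExp_const_mul, bernoulliExp_superset, ← (Finset.mem_filter.1 hc).2]
  rfl

/-! ### Reduction of block-MAP decoding to erasure patterns. -/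

/-- The word received when `x` is sent and the positions in `e` are erased. -/
def erase {N : ℕ} (x : Fin N → ZMod 2) (e : Fin N → Bool) : Fin N → Option (ZMod 2) :=
  fun i => if e i then none else some (x i)

lemma erase_injective {N : ℕ} (x : Fin N → ZMod 2) : Function.Injective (erase x) := by
  intro e e' h
  ext i
  have := congrFun h i
  unfold erase at this
  cases he : e i <;> cases he' : e' i <;> simp_all

lemma becProb_erase {N : ℕ} (ε : ℝ) (x : Fin N → ZMod 2) (e : Fin N → Bool) :
    becProb ε x (erase x e) = ∏ i, if e i then ε else 1 - ε := by
  refine Finset.prod_congr rfl fun i _ => ?_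
  unfold erase
  cases e i <;> simp [becLetter]

lemma becProb_eq_zero {N : ℕ} (ε : ℝ) (x : Fin N → ZMod 2) {y : Fin N → Option (ZMod 2)}
    (hy : y ∉ Set.range (erase x)) : becProb ε x y = 0 := by
  by_contra h
  refine hy ⟨fun i => (y i).isNone, ?_⟩
  ext1 i
  have hi := Finset.prod_ne_zero_iff.1 h i (Finset.mem_univ i)
  unfold erase
  cases hyi : y i with
  | none => simp [hyi]
  | some c =>
    rw [hyi] at hi
    simp only [becLetter, ne_eq, ite_eq_right_iff, not_forall] at hi
    simp [hyi, hi.1]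

/-- All words agreeing with `x` off the erasures have the same positive likelihood, and all others
have likelihood zero. An error thus means a tie, and the difference of the tied codewords is
supported on the erasures. -/
lemma isBlockMAPError_erase_iff {N : ℕ} (C : Submodule (ZMod 2) (Fin N → ZMod 2)) {ε : ℝ}
    (h0 : 0 < ε) (h1 : ε < 1) {x : Fin N → ZMod 2} (hx : x ∈ C) (e : Fin N → Bool) :
    IsBlockMAPError C ε x (erase x e) ↔ e ∈ uncorrectable C := by
  constructor
  · rintro ⟨x', hx', hne, hle⟩
    refine ⟨x' - x, C.sub_mem hx' hx, sub_ne_zero.2 hne, fun i hi => ?_⟩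
    have hpos : 0 < becProb ε x (erase x e) := by
      rw [becProb_erase]
      refine Finset.prod_pos fun i _ => ?_
      split_ifs <;> linarith
    have h := Finset.prod_ne_zero_iff.1 (hpos.trans_le hle).ne' i (Finset.mem_univ i)
    by_contra he
    refine h ?_
    have hxi : x i ≠ x' i := fun hh => hi (by simp [hh])
    simp [erase, he, becLetter, hxi]
  · rintro ⟨c, hc, hc0, hce⟩
    refine ⟨x + c, C.add_mem hx hc, by simpa using hc0, le_of_eq ?_⟩
    refine Finset.prod_congr rfl fun i _ => ?_
    by_cases hi : c i = 0
    · simp [hi]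
    · simp [erase, hce i hi, becLetter]

lemma blockMAPErrorProb_eq_bernoulliProb {N : ℕ} (C : Submodule (ZMod 2) (Fin N → ZMod 2)) {ε : ℝ}
    (h0 : 0 < ε) (h1 : ε < 1) :
    blockMAPErrorProb C ε = bernoulliProb ε (uncorrectable C) := by
  classical
  have key : ∀ x : C, ∑ y : Fin N → Option (ZMod 2),
      (if IsBlockMAPError C ε (x : Fin N → ZMod 2) y then becProb ε (x : Fin N → ZMod 2) y else 0)
      = bernoulliProb ε (uncorrectable C) := fun x => by
    symm
    refine Finset.sum_of_injOn (erase (x : Fin N → ZMod 2)) (erase_injective _).injOn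
      (fun _ _ => Finset.mem_coe.2 (Finset.mem_univ _)) ?_ ?_
    · intro y _ hy
      rw [becProb_eq_zero ε _ (by simpa using hy), ite_self]
    · intro e _
      simp only [isBlockMAPError_erase_iff C h0 h1 x.2, becProb_erase, mul_ite, mul_one, mul_zero]
  rw [blockMAPErrorProb]
  have hcard : (Fintype.card C : ℝ) ≠ 0 := Nat.cast_ne_zero.2 Fintype.card_ne_zero
  convert_to ∑ x : C, (1 / (Fintype.card C : ℝ)) * bernoulliProb ε (uncorrectable C) = _
  · refine Finset.sum_congr rfl fun x _ => ?_
    rw [← key x]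
  · rw [Finset.sum_const, Finset.card_univ, nsmul_eq_mul]
    field_simp

/-! ### Comparison principle for differential inequalities. -/

/-- If `u + S` is nondecreasing wherever `u` is positive, and `u` is nonpositive at the right end,
then `u` exceeds zero at the left end by at most the increase of `S`. -/
lemma left_le_sub_of_hasDerivAt {u S : ℝ → ℝ} {a b : ℝ} (hab : a ≤ b)
    (hu : ContinuousOn u (Set.Icc a b)) (hS : ContinuousOn S (Set.Icc a b))
    (hmono : MonotoneOn S (Set.Icc a b)) (hub : u b ≤ 0)
    (h : ∀ x ∈ Set.Ioo a b, 0 < u x → ∃ d, 0 ≤ d ∧ HasDerivAt (fun y => u y + S y) d x) :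
    u a ≤ S b - S a := by
  have hSab := hmono (Set.left_mem_Icc.2 hab) (Set.right_mem_Icc.2 hab) hab
  have hcl : IsClosed (Set.Icc a b ∩ u ⁻¹' Set.Iic 0) :=
    hu.preimage_isClosed_of_isClosed isClosed_Icc isClosed_Iic
  have hcpt := isCompact_Icc.of_isClosed_subset hcl Set.inter_subset_left
  -- Up to the first point `t` where `u` is nonpositive the derivative condition applies; beyond `t`
  -- only the monotonicity of `S` is needed.
  obtain ⟨t, ⟨htI, htu⟩, hleast⟩ := hcpt.exists_isLeast ⟨b, Set.right_mem_Icc.2 hab, hub⟩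
  have hsub : Set.Icc a t ⊆ Set.Icc a b := Set.Icc_subset_Icc_right htI.2
  have hd : ∀ x ∈ Set.Ioo a t, ∃ d, 0 ≤ d ∧ HasDerivAt (fun y => u y + S y) d x := fun x hx => by
    refine h x ⟨hx.1, hx.2.trans_le htI.2⟩ ?_
    by_contra! hux
    exact (hleast ⟨hsub ⟨hx.1.le, hx.2.le⟩, hux⟩).not_gt hx.2
  have hK : MonotoneOn (fun y => u y + S y) (Set.Icc a t) := by
    refine monotoneOn_of_deriv_nonneg (convex_Icc a t) ((hu.add hS).mono hsub) ?_ ?_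
    · rw [interior_Icc]
      intro x hx
      obtain ⟨d, _, hd⟩ := hd x hx
      exact hd.differentiableAt.differentiableWithinAt
    · rw [interior_Icc]
      intro x hx
      obtain ⟨d, hd0, hd⟩ := hd x hx
      rwa [hd.deriv]
  have h1 := hK (Set.left_mem_Icc.2 htI.1) (Set.right_mem_Icc.2 htI.1) htI.1
  have h2 := hmono htI (Set.right_mem_Icc.2 hab) htI.2
  have h3 : u t ≤ 0 := htu
  simp only at h1
  linarith

/-- Mirror image of the previous lemma under x ↦ -x, with S(x) replaced by -S(-x). -/
lemma right_le_sub_of_hasDerivAt {u S : ℝ → ℝ} {a b : ℝ} (hab : a ≤ b)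
    (hu : ContinuousOn u (Set.Icc a b)) (hS : ContinuousOn S (Set.Icc a b))
    (hmono : MonotoneOn S (Set.Icc a b)) (hua : u a ≤ 0)
    (h : ∀ x ∈ Set.Ioo a b, 0 < u x → ∃ d, 0 ≤ d ∧ HasDerivAt (fun y => S y - u y) d x) :
    u b ≤ S b - S a := by
  have hmem : Set.MapsTo (fun x : ℝ => -x) (Set.Icc (-b) (-a)) (Set.Icc a b) := fun x hx =>
    ⟨by linarith [hx.2], by linarith [hx.1]⟩
  have := left_le_sub_of_hasDerivAt (u := fun x => u (-x)) (S := fun x => -S (-x))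
    (neg_le_neg hab) (hu.comp continuous_neg.continuousOn hmem)
    (hS.comp continuous_neg.continuousOn hmem).neg
    (fun x hx y hy hxy => neg_le_neg (hmono (hmem hy) (hmem hx) (neg_le_neg hxy)))
    (by simpa using hua) (fun x hx hux => by
      obtain ⟨d, hd0, hd⟩ := h (-x) ⟨by linarith [hx.2], by linarith [hx.1]⟩ hux
      refine ⟨d, hd0, ?_⟩
      refine ((hd.comp x (hasDerivAt_neg x)).neg.congr_deriv (by ring)).congr_of_eventuallyEq
        (Eventually.of_forall fun y => ?_)
      change u (-y) + -S (-y) = -(S (-y) - u (-y))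
      ring)
  simp only [neg_neg] at this
  linarith

lemma bernoulliProb_le_bernoulliProb {n : ℕ} {S : Set (Fin n → Bool)} (hS : IsUpperSet S)
    {p q : ℝ} (hp : 0 < p) (hpq : p ≤ q) (hq : q < 1) :
    bernoulliProb p S ≤ bernoulliProb q S := by
  have hd : ∀ x ∈ Set.Ioo (0 : ℝ) 1, HasDerivAt (fun q => bernoulliProb q S)
      (bernoulliExp x (fun y => ((pivotal S y).ncard : ℝ)) / x) x := fun x hx =>
    hasDerivAt_bernoulliProb hS hx.1.ne'
  have hm : MonotoneOn (fun q => bernoulliProb q S) (Set.Ioo 0 1) := by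
    refine monotoneOn_of_deriv_nonneg (convex_Ioo 0 1)
      (fun x hx => (hd x hx).continuousAt.continuousWithinAt) ?_ ?_
    · rw [interior_Ioo]
      exact fun x hx => (hd x hx).differentiableAt.differentiableWithinAt
    · rw [interior_Ioo]
      intro x hx
      rw [(hd x hx).deriv]
      refine div_nonneg ?_ hx.1.le
      rw [← bernoulliExp_const (n := n) x 0]
      exact bernoulliExp_mono hx.1.le hx.2.le fun y => by positivity
  exact hm ⟨hp, hpq.trans_lt hq⟩ ⟨hp.trans_le hpq, hq⟩ hpq

/-! ### The small-weight cost and the Gaussian comparison curve. -/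

/-- An antiderivative of the contribution of the codewords of weight at most `W`. -/
noncomputable def smallWeightPotential {N : ℕ} (C : Submodule (ZMod 2) (Fin N → ZMod 2)) (W : ℕ)
    (p : ℝ) : ℝ :=
  Real.sqrt W * ∑ w ∈ Finset.Icc 1 W, weightDistribution C w / Real.sqrt w * p ^ w

lemma hasDerivAt_smallWeightPotential {N : ℕ} (C : Submodule (ZMod 2) (Fin N → ZMod 2)) (W : ℕ)
    {p : ℝ} (hp : p ≠ 0) :
    HasDerivAt (smallWeightPotential C W)
      (Real.sqrt W / p * ∑ w ∈ Finset.Icc 1 W, Real.sqrt w * weightDistribution C w * p ^ w) p := by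
  have h := (HasDerivAt.fun_sum (u := Finset.Icc 1 W) fun w _ =>
    (hasDerivAt_pow w p).const_mul (weightDistribution C w / Real.sqrt w)).const_mul (Real.sqrt W)
  refine HasDerivAt.congr_deriv h ?_
  rw [div_mul_eq_mul_div, mul_div_assoc, Finset.sum_div]
  congr 1
  refine Finset.sum_congr rfl fun w hw => ?_
  obtain ⟨k, rfl⟩ : ∃ k, w = k + 1 := ⟨w - 1, by have := (Finset.mem_Icc.1 hw).1; omega⟩
  have hk : (0 : ℝ) < ((k + 1 : ℕ) : ℝ) := by positivity
  have hs := Real.sqrt_pos.2 hk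
  have hsq := Real.sq_sqrt hk.le
  rw [Nat.add_sub_cancel, pow_succ]
  generalize Real.sqrt ((k + 1 : ℕ) : ℝ) = s at *
  rw [← hsq]
  field_simp

lemma smallWeightPotential_mono {N : ℕ} (C : Submodule (ZMod 2) (Fin N → ZMod 2)) (W : ℕ)
    {a b : ℝ} (ha : 0 ≤ a) (hab : a ≤ b) :
    smallWeightPotential C W a ≤ smallWeightPotential C W b := by
  unfold smallWeightPotential
  gcongr

lemma smallWeightPotential_sub_le {N : ℕ} (C : Submodule (ZMod 2) (Fin N → ZMod 2)) (W : ℕ)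
    {a b : ℝ} (ha : 0 < a) (hab : a < b) (hb : b < 1) :
    smallWeightPotential C W b - smallWeightPotential C W a ≤
      2 * Real.sqrt (-Real.log a) * Real.sqrt W * truncWeightEnumerator C W b := by
  have hl : 0 < -Real.log a := by linarith [Real.log_neg ha (hab.trans hb)]
  have key : ∀ w ∈ Finset.Icc 1 W, weightDistribution C w / Real.sqrt w * b ^ w -
      weightDistribution C w / Real.sqrt w * a ^ w ≤
      2 * Real.sqrt (-Real.log a) * (weightDistribution C w * b ^ w) := by
    intro w hw
    have hw0 : (0 : ℝ) < w := by exact_mod_cast (Finset.mem_Icc.1 hw).1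
    have hs := Real.sqrt_pos.2 hw0
    have haw : a ^ w = Real.exp (-(w * -Real.log a)) := by
      rw [mul_neg, neg_neg, Real.exp_nat_mul, Real.exp_log ha]
    have hbw : 0 < b ^ w := pow_pos (ha.trans hab) w
    have hbw1 : b ^ w ≤ 1 := pow_le_one₀ (ha.trans hab).le hb.le
    have haw0 : 0 < a ^ w := pow_pos ha w
    have haw1 : a ^ w ≤ 1 := pow_le_one₀ ha.le (hab.trans hb).le
    -- With t = 1 - a^w in [0, 1], t² ≤ t ≤ -w ln a. The root of w cancels the one in the potential.
    have h1 : 1 - a ^ w ≤ Real.sqrt w * Real.sqrt (-Real.log a) := by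
      rw [← Real.sqrt_mul hw0.le]
      apply Real.le_sqrt_of_sq_le
      have := Real.add_one_le_exp (-(w * -Real.log a))
      rw [← haw] at this
      nlinarith
    -- Since b^w ≤ 1, b^w - a^w ≤ b^w (1 - a^w). The factor 2 is slack here.
    have h2 : (b ^ w - a ^ w) / Real.sqrt w ≤ 2 * Real.sqrt (-Real.log a) * b ^ w := by
      rw [div_le_iff₀ hs]
      have h3 : 0 ≤ Real.sqrt w * Real.sqrt (-Real.log a) := by positivity
      nlinarith
    calc _ = weightDistribution C w * ((b ^ w - a ^ w) / Real.sqrt w) := by ring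
      _ ≤ weightDistribution C w * (2 * Real.sqrt (-Real.log a) * b ^ w) := by gcongr
      _ = _ := by ring
  unfold smallWeightPotential truncWeightEnumerator
  rw [← mul_sub, ← Finset.sum_sub_distrib]
  calc _ ≤ Real.sqrt W * ∑ w ∈ Finset.Icc 1 W,
        2 * Real.sqrt (-Real.log a) * (weightDistribution C w * b ^ w) :=
        mul_le_mul_of_nonneg_left (Finset.sum_le_sum key) (Real.sqrt_nonneg _)
    _ = _ := by rw [← Finset.mul_sum]; ring

/-- A lower bound for the derivative of the probability of an uncorrectable erasure pattern. -/
lemma gaussianProfile_le_pivotal_add {N : ℕ} (C : Submodule (ZMod 2) (Fin N → ZMod 2)) (W : ℕ)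
    {p : ℝ} (h0 : 0 < p) (h1 : p < 1) :
    Real.sqrt W / (2 * Real.sqrt (-Real.log p)) *
        gaussianProfile (bernoulliProb p (uncorrectable C)) ≤
      bernoulliExp p (fun e => ((pivotal (uncorrectable C) e).ncard : ℝ)) +
      Real.sqrt W * ∑ w ∈ Finset.Icc 1 W, Real.sqrt w * weightDistribution C w * p ^ w := by
  have hl : 0 < Real.sqrt (-Real.log p) := Real.sqrt_pos.2 (by linarith [Real.log_neg h0 h1])
  set h : (Fin N → Bool) → ℕ := fun e => (pivotal (uncorrectable C) e).ncard
  have hiso := gaussianProfile_bernoulliProb_le (isUpperSet_uncorrectable C) h0 h1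
  -- If h > W then √W √h ≤ h; otherwise the left side itself appears as the second term on the
  -- right.
  have hpt : bernoulliExp p (fun e => Real.sqrt W * Real.sqrt (h e)) ≤
      bernoulliExp p (fun e => (h e : ℝ) +
        Real.sqrt W * if h e ≤ W then Real.sqrt (h e) else 0) := by
    refine bernoulliExp_mono h0.le h1.le fun e => ?_
    split_ifs with hW
    · have : (0 : ℝ) ≤ h e := by positivity
      linarith
    · have hWh : Real.sqrt W ≤ Real.sqrt (h e) :=
        Real.sqrt_le_sqrt (by exact_mod_cast (not_le.1 hW).le)
      calc _ ≤ Real.sqrt (h e) * Real.sqrt (h e) := by gcongr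
        _ = _ := by rw [Real.mul_self_sqrt (by positivity)]; ring
  rw [bernoulliExp_const_mul, bernoulliExp_add, bernoulliExp_const_mul] at hpt
  have hsm := mul_le_mul_of_nonneg_left (bernoulliExp_sqrt_pivotal_le C W h0.le h1.le)
    (Real.sqrt_nonneg W)
  calc _ ≤ Real.sqrt W / (2 * Real.sqrt (-Real.log p)) * (2 * Real.sqrt (-Real.log p) *
        bernoulliExp p (fun e => Real.sqrt (h e))) := by gcongr
    _ = Real.sqrt W * bernoulliExp p (fun e => Real.sqrt (h e)) := by field_simp
    _ ≤ _ := by linarith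

/-- The Gaussian curve with which the error probability is compared. -/
noncomputable def gaussianThreshold (W : ℕ) (εs p : ℝ) : ℝ :=
  stdNormalCDF (Real.sqrt W * (Real.sqrt (-Real.log εs) - Real.sqrt (-Real.log p)))

/-- The curve solves exactly the differential equation that f satisfies as an inequality up to the
small-weight cost. -/
lemma hasDerivAt_gaussianThreshold (W : ℕ) (εs : ℝ) {p : ℝ} (h0 : 0 < p) (h1 : p < 1) :
    HasDerivAt (gaussianThreshold W εs)
      (Real.sqrt W / (2 * Real.sqrt (-Real.log p)) * gaussianProfile (gaussianThreshold W εs p) / p)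
      p := by
  have hl : 0 < -Real.log p := by linarith [Real.log_neg h0 h1]
  have hs := Real.sqrt_pos.2 hl
  have e := (hasDerivAt_stdNormalCDF _).comp p ((((Real.hasDerivAt_log h0.ne').neg.sqrt
    hl.ne').const_sub (Real.sqrt (-Real.log εs))).const_mul (Real.sqrt W))
  refine HasDerivAt.congr_deriv e ?_
  rw [gaussianThreshold, gaussianProfile_cdf]
  simp only [Pi.neg_apply]
  field_simp

lemma gaussianThreshold_self (W : ℕ) (εs : ℝ) : gaussianThreshold W εs εs = 1 / 2 := by
  rw [gaussianThreshold, sub_self, mul_zero, stdNormalCDF_zero]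

/-! ### The threshold bounds on both sides of ε*. -/

theorem theorem2 (N : ℕ) (C : Submodule (ZMod 2) (Fin N → ZMod 2))
    (εs : ℝ) (hεs0 : 0 < εs) (hεs1 : εs < 1) (hεs : blockMAPErrorProb C εs = 1 / 2)
    (W : ℕ) (hW1 : 1 ≤ W) (hWN : W ≤ N) :
    (∀ ε : ℝ, 0 < ε → ε < εs →
      blockMAPErrorProb C ε ≤
        stdNormalCDF (Real.sqrt W * (Real.sqrt (-Real.log εs) - Real.sqrt (-Real.log ε)))
          + 2 * Real.sqrt (-Real.log ε) * Real.sqrt W * truncWeightEnumerator C W εs) ∧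
    (∀ ε : ℝ, εs < ε → ε < 1 →
      stdNormalCDF (Real.sqrt W * (Real.sqrt (-Real.log εs) - Real.sqrt (-Real.log ε)))
          - 2 * Real.sqrt (-Real.log εs) * Real.sqrt W * truncWeightEnumerator C W ε
        ≤ blockMAPErrorProb C ε) := by
  rw [blockMAPErrorProb_eq_bernoulliProb C hεs0 hεs1] at hεs
  have hup := isUpperSet_uncorrectable C
  set f : ℝ → ℝ := fun p => bernoulliProb p (uncorrectable C) with hf
  set G : ℝ → ℝ := gaussianThreshold W εs with hG
  set S : ℝ → ℝ := smallWeightPotential C W with hS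
  have hderiv : ∀ p, 0 < p → p < 1 → gaussianProfile (G p) ≤ gaussianProfile (f p) →
      ∃ d, 0 ≤ d ∧ HasDerivAt (fun q => f q - G q + S q) d p := by
    intro p h0 h1 hle
    refine ⟨_, ?_, ((hasDerivAt_bernoulliProb hup h0.ne').sub
      (hasDerivAt_gaussianThreshold W εs h0 h1)).add (hasDerivAt_smallWeightPotential C W h0.ne')⟩
    have hb := gaussianProfile_le_pivotal_add C W h0 h1
    have hb' : Real.sqrt W / (2 * Real.sqrt (-Real.log p)) * gaussianProfile (G p) ≤
      Real.sqrt W / (2 * Real.sqrt (-Real.log p)) * gaussianProfile (f p) := by gcongr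
    rw [← sub_div, div_mul_eq_mul_div _ p, ← add_div]
    exact div_nonneg (by linarith) h0.le
  have hfc : ∀ p, 0 < p → ContinuousAt f p := fun p h0 =>
    (hasDerivAt_bernoulliProb hup h0.ne').continuousAt
  have hGc : ∀ p, 0 < p → p < 1 → ContinuousAt G p := fun p h0 h1 =>
    (hasDerivAt_gaussianThreshold W εs h0 h1).continuousAt
  have hSc : ∀ p, 0 < p → ContinuousAt S p := fun p h0 =>
    (hasDerivAt_smallWeightPotential C W h0.ne').continuousAt
  have hG0 : ∀ p, 0 < G p := fun p => stdNormalCDF_pos _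
  have hG1 : ∀ p, G p < 1 := fun p => stdNormalCDF_lt_one _
  have hGs : G εs = 1 / 2 := gaussianThreshold_self W εs
  have hfs : f εs = 1 / 2 := hεs
  constructor
  · intro ε h0 h1
    rw [blockMAPErrorProb_eq_bernoulliProb C h0 (h1.trans hεs1)]
    have key := left_le_sub_of_hasDerivAt (u := fun p => f p - G p) (S := S) h1.le
      (fun p hp => ((hfc p (h0.trans_le hp.1)).sub
        (hGc p (h0.trans_le hp.1) (hp.2.trans_lt hεs1))).continuousWithinAt)
      (fun p hp => (hSc p (h0.trans_le hp.1)).continuousWithinAt)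
      (fun p hp q hq hpq => smallWeightPotential_mono C W (h0.le.trans hp.1) hpq)
      (by simp [hGs, hfs])
      -- Below ε*, G < f ≤ 1/2, where the profile is increasing.
      (fun p hp hpos => hderiv p (h0.trans hp.1) (hp.2.trans hεs1)
        (gaussianProfile_mono (hG0 p).le (sub_nonneg.1 hpos.le)
          (hfs ▸ bernoulliProb_le_bernoulliProb hup (h0.trans hp.1) hp.2.le hεs1)))
    have := smallWeightPotential_sub_le C W h0 h1 hεs1
    change f ε ≤ G ε + _
    linarith
  · intro ε h0 h1
    have hε0 := hεs0.trans h0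
    rw [blockMAPErrorProb_eq_bernoulliProb C hε0 h1]
    have key := right_le_sub_of_hasDerivAt (u := fun p => G p - f p) (S := S) h0.le
      (fun p hp => ((hGc p (hεs0.trans_le hp.1) (hp.2.trans_lt h1)).sub
        (hfc p (hεs0.trans_le hp.1))).continuousWithinAt)
      (fun p hp => (hSc p (hεs0.trans_le hp.1)).continuousWithinAt)
      (fun p hp q hq hpq => smallWeightPotential_mono C W (hεs0.le.trans hp.1) hpq)
      (by simp [hGs, hfs])
      -- Above ε*, 1/2 ≤ f < G, where the profile is decreasing, so again I(G) ≤ I(f).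
      (fun p hp hpos => by
        obtain ⟨d, hd0, hd⟩ := hderiv p (hεs0.trans hp.1) (hp.2.trans h1)
          (gaussianProfile_anti
            (hfs ▸ bernoulliProb_le_bernoulliProb hup hεs0 hp.1.le (hp.2.trans h1))
            (sub_nonneg.1 hpos.le) (hG1 p).le)
        refine ⟨d, hd0, ?_⟩
        convert hd using 1
        ext y; ring)
    have := smallWeightPotential_sub_le C W hεs0 h0 h1
    change G ε - _ ≤ f ε
    linarith
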